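/- All distributive lattices are bounded, and lattice homomorphisms preserve $0$ and $1$. A distributive lattice $D$ is *normal* if $a\vee b=1$ implies that there are $c,d\in D$ with $c\vee a=b\vee d=1$ and $c\wedge d=0$; it is *conjunctive* if $a\le b$ whenever every $c\in D$ with $a\vee c=1$ satisfies $b\vee c=1$. An *Alexandrov algebra* is a normal distributive lattice $D$ in which countable joins exist and distribute over finite meets, and such that for every $a\in D$ there are sequences $(b_n)_{n\in\mathbb N}$, $(c_n)_{n\in\mathbb N}$ in $D$ with $\bigvee_n c_n=a$ and, for all $n$, $b_n\wedge c_n=0$ and $b_n\vee a=1$. It is *countably compact* if every sequence $(c_n)_{n\in\mathbb N}$ with $\bigvee_n c_n=1$ has a finite subfamily with join $1$. Let $\mathbf{AlexAlg}_c$ be the category of countably compact Alexandrov algebras and lattice homomorphisms preserving countable joins. For an Alexandrov algebra $D$, let $Id_{C_D}(D)$ be the frame of lower sets of $D$ closed under countable joins. A countable-join-preserving homomorphism $f:D\to D'$ induces a frame homomorphism $Id_{C_D}(D)\to Id_{C_{D'}}(D')$ that sends $I$ to the ideal generated by $f(I)$. Let $C(D)$ be the space of points of $Id_{C_D}(D)$,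 and $C(f):C(D')\to C(D)$ the induced continuous map. For a distributive lattice $D$, let $Max(D)$ be the set of maximal ideals of $D$, with the topology generated by the sets $\{M : d\notin M\}$, $d\in D$. A lattice homomorphism $f:D\to D'$ is *maximal* if $f^{-1}(M)$ is a maximal ideal of $D$ for every maximal ideal $M$ of $D'$; then $Max(f):Max(D')\to Max(D)$ is $M\mapsto f^{-1}(M)$. For a compact Hausdorff space $X$, let $Coz(X)$ be the lattice of open sets of the form $\{x : f(x)\neq 0\}$ with $f:X\to\mathbb R$ continuous; a continuous map $g:X\to Y$ induces $Coz(g)=g^{-1}:Coz(Y)\to Coz(X)$. Let $\mathbf{CHDLat}$ be the category whose objects are the conjunctive distributive lattices isomorphic to $Coz(X)$ for some compact Hausdorff space $X$, and whose morphisms are the maximal homomorphisms. Let $\mathbf{CHaus}$ be the category of compact Hausdorff spaces and continuous maps. **Theorem.** 1. The functors $Coz:\mathbf{CHaus}^{\mathrm{op}}\to\mathbf{AlexAlg}_c$ and $C:\mathbf{AlexAlg}_c\to\mathbf{CHaus}^{\mathrm{op}}$ are mutually inverse equivalences of categories (up to natural isomorphism). 2. The functors $Coz:\mathbf{CHaus}^{\mathrm{op}}\to\mathbf{CHDLat}$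 and $Max:\mathbf{CHDLat}\to\mathbf{CHaus}^{\mathrm{op}}$ are mutually inverse equivalences of categories (up to natural isomorphism). 3. $\mathbf{AlexAlg}_c$ and $\mathbf{CHDLat}$ are the same subcategory of the category of distributive lattices: they have the same objects, and a lattice homomorphism between two such objects preserves countable joins if and only if it is maximal. Under this identification, the functors $C$ and $Max$ are naturally isomorphic. -/

import Mathlib

open CategoryTheory Opposite

universe u

/-! ### Bounded distributive lattices -/

section Lattices

variable (D : Type u) [DistribLattice D] [BoundedOrder D]

/-- A bounded distributive lattice is normal if `a ⊔ b = ⊤` implies that there are `c`, `d` with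
`c ⊔ a = ⊤`, `b ⊔ d = ⊤` and `c ⊓ d = ⊥`. -/
def IsNormalLattice : Prop :=
  ∀ a b : D, a ⊔ b = ⊤ → ∃ c d : D, c ⊔ a = ⊤ ∧ b ⊔ d = ⊤ ∧ c ⊓ d = ⊥

/-- A bounded distributive lattice is conjunctive if `a ≤ b` whenever every `c` with `a ⊔ c = ⊤`
satisfies `b ⊔ c = ⊤`. -/
def IsConjunctive : Prop :=
  ∀ a b : D, (∀ c : D, a ⊔ c = ⊤ → b ⊔ c = ⊤) → a ≤ b

/-- Alexandrov algebras: normal distributive lattices in which countable joins exist and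
distribute over finite meets, and which have the approximation property. -/
class IsAlexandrovAlgebra : Prop where
  normal : IsNormalLattice D
  exists_isLUB : ∀ S : Set D, S.Countable → ∃ x, IsLUB S x
  inf_isLUB : ∀ (a : D) (S : Set D) (x : D), S.Countable → IsLUB S x →
    IsLUB ((fun s => a ⊓ s) '' S) (a ⊓ x)
  approximation : ∀ a : D, ∃ b c : ℕ → D, IsLUB (Set.range c) a ∧
    ∀ n, b n ⊓ c n = ⊥ ∧ b n ⊔ a = ⊤

/-- Every sequence with join `⊤` has a finite subfamily with join `⊤`. -/
def IsCountablyCompactLattice : Prop :=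
  ∀ c : ℕ → D, IsLUB (Set.range c) ⊤ → ∃ H : Finset ℕ, H.sup c = ⊤

variable {D} {E : Type u} [DistribLattice E] [BoundedOrder E]

/-- A lattice homomorphism preserves (all existing) countable joins. -/
def PreservesCountableJoins (f : BoundedLatticeHom D E) : Prop :=
  ∀ (S : Set D) (x : D), S.Countable → IsLUB S x → IsLUB (f '' S) (f x)

/-- The inverse image of an ideal along a lattice homomorphism. -/
def idealPreimage (f : BoundedLatticeHom D E) (I : Order.Ideal E) : Order.Ideal D where
  carrier := {d | f d ∈ I}
  lower' := fun _ _ hba ha => I.lower (OrderHomClass.mono f hba) ha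
  nonempty' := ⟨⊥, by simp⟩
  directed' := fun a ha b hb => ⟨a ⊔ b, by
    simpa using Order.Ideal.sup_mem (s := I) ha hb, le_sup_left, le_sup_right⟩

@[simp] theorem mem_idealPreimage (f : BoundedLatticeHom D E) (I : Order.Ideal E) (d : D) :
    d ∈ idealPreimage f I ↔ f d ∈ I := Iff.rfl

/-- A lattice homomorphism is maximal if inverse image of ideals (that is, the induced map between
prime spectra) sends maximal ideals to maximal ideals. -/
def IsMaximalHom (f : BoundedLatticeHom D E) : Prop :=
  ∀ M : Order.Ideal E, M.IsMaximal → (idealPreimage f M).IsMaximal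

end Lattices

/-! ### Subcategories of the category of bounded distributive lattices -/

/-- The objects of the subcategory of `BddDistLat` on the lattices satisfying `P` and the
homomorphisms satisfying `W`. -/
structure SubDLat (P : BddDistLat.{u} → Prop) (W : MorphismProperty BddDistLat.{u}) where
  obj : BddDistLat.{u}
  property : P obj

namespace SubDLat

variable {P Q : BddDistLat.{u} → Prop} {W V : MorphismProperty BddDistLat.{u}}

/-- The morphisms of the subcategory: the homomorphisms satisfying `W`. -/
@[ext]
structure Hom (X Y : SubDLat P W) where
  hom : X.obj ⟶ Y.obj
  property : W hom

instance [W.IsMultiplicative] : Category (SubDLat P W) where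
  Hom X Y := Hom X Y
  id X := ⟨𝟙 X.obj, W.id_mem X.obj⟩
  comp f g := ⟨f.hom ≫ g.hom, W.comp_mem _ _ f.property g.property⟩

/-- If two subcategories have the same objects and the same morphisms, this is the identification
of the first with the second: the identity on objects and on morphisms. -/
def identification [W.IsMultiplicative] [V.IsMultiplicative] (hobj : ∀ D, P D ↔ Q D)
    (hmor : ∀ (D E : BddDistLat.{u}), P D → P E → ∀ f : D ⟶ E, W f ↔ V f) :
    SubDLat P W ⥤ SubDLat Q V where
  obj X := ⟨X.obj, (hobj X.obj).1 X.property⟩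
  map {X Y} f := ⟨f.hom, (hmor X.obj Y.obj X.property Y.property f.hom).1 f.property⟩

end SubDLat

/-- The homomorphisms preserving countable joins, as a class of morphisms. -/
def countableJoinHoms : MorphismProperty BddDistLat.{u} :=
  fun _ _ f => PreservesCountableJoins f.hom

instance : countableJoinHoms.{u}.IsMultiplicative where
  id_mem _ S x _ hx := by simpa using hx
  comp_mem f g hf hg S x hS hx := by
    have := hg _ _ (hS.image _) (hf S x hS hx)
    simpa [Set.image_image] using this

/-- The maximal homomorphisms, as a class of morphisms. -/
def maximalHoms : MorphismProperty BddDistLat.{u} :=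
  fun _ _ f => IsMaximalHom f.hom

instance : maximalHoms.{u}.IsMultiplicative where
  id_mem _ _ hM := hM
  comp_mem _ _ hf hg M hM := hf _ (hg M hM)

/-- The lattice is a countably compact Alexandrov algebra. -/
def IsCountablyCompactAlexandrov (D : BddDistLat.{u}) : Prop :=
  IsAlexandrovAlgebra D ∧ IsCountablyCompactLattice D

/-- The category of countably compact Alexandrov algebras and lattice homomorphisms preserving
countable joins. -/
abbrev AlexAlgC := SubDLat.{u} IsCountablyCompactAlexandrov countableJoinHoms

/-! ### The frame of ideals for the countable topology -/

section CountableIdeals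

variable (D : Type u) [DistribLattice D] [BoundedOrder D]

/-- The ideals for the countable topology, whose covering sieves on `x` are those that contain a
countable family with join `x`: lower sets `I` such that `x ∈ I` as soon as `I` contains a
countable family with join `x`. -/
@[ext]
structure CIdeal where
  toLowerSet : LowerSet D
  mem_of_isLUB : ∀ (S : Set D) (x : D), S.Countable → S ⊆ toLowerSet → IsLUB S x → x ∈ toLowerSet

namespace CIdeal

variable {D}

/-- Ideals are ordered by inclusion. -/
instance : PartialOrder (CIdeal D) :=
  PartialOrder.lift CIdeal.toLowerSet fun _ _ h => CIdeal.ext h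

theorem le_def {I J : CIdeal D} : I ≤ J ↔ I.toLowerSet ≤ J.toLowerSet := Iff.rfl

/-- The principal ideal of an element. -/
def principal (a : D) : CIdeal D :=
  ⟨LowerSet.Iic a, fun _ _ _ hSa hx => hx.2 hSa⟩

theorem principal_le {a : D} {I : CIdeal D} : principal a ≤ I ↔ a ∈ I.toLowerSet :=
  LowerSet.Iic_le

variable [hD : IsAlexandrovAlgebra D]

/-- The ideal generated by a lower set `K`: the joins of countable families in `K`. -/
def cl (K : LowerSet D) : CIdeal D where
  toLowerSet :=
   { carrier := {x | ∃ S : Set D, S.Countable ∧ S ⊆ K ∧ IsLUB S x}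
     lower' := by
      rintro x y hyx ⟨S, hS, hSK, hx⟩
      refine ⟨(fun s => y ⊓ s) '' S, hS.image _, ?_, ?_⟩
      · rintro _ ⟨s, hs, rfl⟩
        exact K.lower inf_le_right (hSK hs)
      · have := hD.inf_isLUB y S x hS hx
        rwa [inf_eq_left.2 hyx] at this }
  mem_of_isLUB := by
    intro S x hS hSK hx
    have hSK' : ∀ s ∈ S, ∃ T : Set D, T.Countable ∧ T ⊆ K ∧ IsLUB T s := hSK
    choose! T hT hTK hTx using hSK'
    refine ⟨⋃ s ∈ S, T s, hS.biUnion fun s hs => hT s hs, ?_, ?_, ?_⟩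
    · exact Set.iUnion₂_subset fun s hs => hTK s hs
    · intro t ht
      obtain ⟨s, hs, hts⟩ := Set.mem_iUnion₂.1 ht
      exact ((hTx s hs).1 hts).trans (hx.1 hs)
    · intro y hy
      exact hx.2 fun s hs => (hTx s hs).2 fun t ht => hy (Set.mem_iUnion₂.2 ⟨s, hs, ht⟩)

theorem mem_cl {K : LowerSet D} {x : D} :
    x ∈ (cl K).toLowerSet ↔ ∃ S : Set D, S.Countable ∧ S ⊆ K ∧ IsLUB S x := Iff.rfl

theorem cl_le_iff {K : LowerSet D} {I : CIdeal D} : cl K ≤ I ↔ K ≤ I.toLowerSet := by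
  constructor
  · intro h x hx
    exact le_def.1 h
      (mem_cl.2 ⟨{x}, Set.countable_singleton x, by simpa using hx, isLUB_singleton⟩)
  · rintro h x ⟨S, hS, hSK, hx⟩
    exact I.mem_of_isLUB S x hS (fun s hs => h (hSK hs)) hx

/-- Generating an ideal is left adjoint to the inclusion into lower sets. -/
def gi : GaloisInsertion (cl (D := D)) CIdeal.toLowerSet where
  choice K _ := cl K
  gc _ _ := cl_le_iff
  le_l_u _ := cl_le_iff.1 le_rfl
  choice_eq _ _ := rfl

instance : CompleteLattice (CIdeal D) := gi.liftCompleteLattice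

theorem coe_inf (I J : CIdeal D) : (I ⊓ J).toLowerSet = I.toLowerSet ⊓ J.toLowerSet :=
  gi.gc.u_inf

theorem coe_top : (⊤ : CIdeal D).toLowerSet = ⊤ := gi.gc.u_top

theorem cl_coe (I : CIdeal D) : cl I.toLowerSet = I := gi.l_u_eq I

theorem cl_inf (K L : LowerSet D) : cl (K ⊓ L) = cl K ⊓ cl L := by
  apply le_antisymm
  · exact le_inf (gi.gc.monotone_l inf_le_left) (gi.gc.monotone_l inf_le_right)
  · rw [le_def, coe_inf]
    rintro x ⟨⟨S, hS, hSK, hSx⟩, ⟨T, hT, hTL, hTx⟩⟩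
    refine ⟨Set.image2 (· ⊓ ·) S T, hS.image2 hT _, ?_, ?_, ?_⟩
    · rintro _ ⟨s, hs, t, ht, rfl⟩
      exact ⟨K.lower inf_le_left (hSK hs), L.lower inf_le_right (hTL ht)⟩
    · rintro _ ⟨s, hs, t, ht, rfl⟩
      exact inf_le_left.trans (hSx.1 hs)
    · intro y hy
      refine hSx.2 fun s hs => ?_
      have h := hD.inf_isLUB s T x hT hTx
      rw [inf_eq_left.2 (hSx.1 hs)] at h
      refine h.2 ?_
      rintro _ ⟨t, ht, rfl⟩
      exact hy ⟨s, hs, t, ht, rfl⟩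

theorem sSup_eq_cl (s : Set (CIdeal D)) :
    sSup s = cl (⨆ I ∈ s, I.toLowerSet) := by
  have h := (gi (D := D)).gc
  rw [h.l_iSup₂]
  simp only [cl_coe, sSup_eq_iSup]

/-- The frame of ideals for the countable topology. -/
instance : Order.Frame (CIdeal D) := .ofMinimalAxioms {
  inf_sSup_le_iSup_inf I s := by
    calc I ⊓ sSup s = cl (I.toLowerSet ⊓ ⨆ J ∈ s, J.toLowerSet) := by
          rw [cl_inf, cl_coe, sSup_eq_cl]
      _ ≤ _ := by
        rw [cl_le_iff, inf_iSup₂_eq]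
        refine iSup₂_le fun J hJ => ?_
        rw [← coe_inf]
        exact le_def.1 (le_iSup₂ (f := fun J (_ : J ∈ s) => I ⊓ J) J hJ) }

variable {E : Type u} [DistribLattice E] [BoundedOrder E] [hE : IsAlexandrovAlgebra E]

/-- The inverse image of an ideal along a homomorphism preserving countable joins. -/
def comap (f : BoundedLatticeHom D E) (hf : PreservesCountableJoins f) (J : CIdeal E) :
    CIdeal D where
  toLowerSet :=
    { carrier := {d | f d ∈ J.toLowerSet}
      lower' := fun _ _ hba ha => J.toLowerSet.lower (OrderHomClass.mono f hba) ha }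
  mem_of_isLUB S x hS hSJ hx := by
    refine J.mem_of_isLUB (f '' S) (f x) (hS.image _) ?_ (hf S x hS hx)
    rintro _ ⟨s, hs, rfl⟩
    exact hSJ hs

/-- The frame homomorphism induced by a homomorphism preserving countable joins. It sends `I` to
the ideal generated by the image of `I`. -/
def map (f : BoundedLatticeHom D E) (hf : PreservesCountableJoins f) :
    FrameHom (CIdeal D) (CIdeal E) where
  toFun I := cl (lowerClosure (f '' (I.toLowerSet : Set D)))
  map_inf' I J := by
    rw [← cl_inf, coe_inf]
    congr 1
    apply le_antisymm
    · exact le_inf (lowerClosure_mono (Set.image_mono fun x hx => hx.1))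
        (lowerClosure_mono (Set.image_mono fun x hx => hx.2))
    · rintro x ⟨⟨_, ⟨a, ha, rfl⟩, hxa⟩, ⟨_, ⟨b, hb, rfl⟩, hxb⟩⟩
      exact ⟨f (a ⊓ b), ⟨a ⊓ b, ⟨I.toLowerSet.lower inf_le_left ha,
        J.toLowerSet.lower inf_le_right hb⟩, rfl⟩, (le_inf hxa hxb).trans (map_inf f a b).ge⟩
  map_top' := by
    refine top_le_iff.1 (le_def.2 (le_trans ?_ (cl_le_iff.1 le_rfl)))
    intro x _
    rw [coe_top]
    exact ⟨f ⊤, ⟨⊤, trivial, rfl⟩, by simp⟩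
  map_sSup' s := by
    have gc : GaloisConnection
        (fun I : CIdeal D => cl (lowerClosure (f '' (I.toLowerSet : Set D)))) (comap f hf) := by
      intro I J
      rw [cl_le_iff, lowerClosure_le]
      exact Set.image_subset_iff
    rw [gc.l_sSup, sSup_image]

theorem map_le_iff (f : BoundedLatticeHom D E) (hf : PreservesCountableJoins f) {I : CIdeal D}
    {J : CIdeal E} : map f hf I ≤ J ↔ ∀ a ∈ I.toLowerSet, f a ∈ J.toLowerSet := by
  refine cl_le_iff.trans (lowerClosure_le.trans ?_)
  exact Set.image_subset_iff

theorem map_id (h : PreservesCountableJoins (BoundedLatticeHom.id D)) :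
    map (BoundedLatticeHom.id D) h = FrameHom.id _ := by
  ext1 I
  refine eq_of_forall_ge_iff fun J => ?_
  rw [map_le_iff]
  exact Iff.rfl

theorem map_comp {F : Type u} [DistribLattice F] [BoundedOrder F] [IsAlexandrovAlgebra F]
    (g : BoundedLatticeHom E F) (hg : PreservesCountableJoins g)
    (f : BoundedLatticeHom D E) (hf : PreservesCountableJoins f)
    (h : PreservesCountableJoins (g.comp f)) :
    map (g.comp f) h = (map g hg).comp (map f hf) := by
  ext1 I
  refine eq_of_forall_ge_iff fun J => ?_
  have h2 : ((map g hg).comp (map f hf)) I ≤ J ↔ map f hf I ≤ comap g hg J :=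
    map_le_iff g hg
  rw [map_le_iff, h2, map_le_iff]
  exact Iff.rfl

end CIdeal

end CountableIdeals

/-! ### The space of points of the frame of ideals for the countable topology -/

section Points

variable {D : Type u} [DistribLattice D] [BoundedOrder D]

theorem exists_sup_eq_top_of_isMaximal {M : Order.Ideal D} (hM : M.IsMaximal) {a : D}
    (ha : a ∉ M) : ∃ e ∈ M, e ⊔ a = ⊤ := by
  have h : (M ⊔ Order.Ideal.principal a : Order.Ideal D) = ⊤ :=
    hM.isCoatom.2 _ (Order.Ideal.lt_sup_principal_of_notMem ha)
  have h2 : (⊤ : D) ∈ M ⊔ Order.Ideal.principal a := by rw [h]; trivial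
  obtain ⟨i, hi, j, hj, hij⟩ := Order.Ideal.mem_sup.1 h2
  exact ⟨i, hi, top_le_iff.1 (hij.trans (sup_le_sup_left hj i))⟩

theorem exists_isMaximal_of_finset (A : Set D) (h : ∀ F : Finset D, ↑F ⊆ A → F.sup id ≠ ⊤) :
    ∃ M : Order.Ideal D, M.IsMaximal ∧ A ⊆ M := by
  classical
  let J : Order.Ideal D :=
    { carrier := {x | ∃ F : Finset D, ↑F ⊆ A ∧ x ≤ F.sup id}
      lower' := fun x y hyx ⟨F, hF, hx⟩ => ⟨F, hF, hyx.trans hx⟩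
      nonempty' := ⟨⊥, ∅, by simp, bot_le⟩
      directed' := by
        rintro x ⟨F, hF, hx⟩ y ⟨G, hG, hy⟩
        refine ⟨F.sup id ⊔ G.sup id, ⟨F ∪ G, by simp [hF, hG], ?_⟩,
          hx.trans le_sup_left, hy.trans le_sup_right⟩
        rw [Finset.sup_union] }
  have hJ : J.IsProper := by
    rw [Order.Ideal.isProper_iff_top_notMem]
    rintro ⟨F, hF, hx⟩
    exact h F hF (top_le_iff.1 hx)
  obtain ⟨M, hJM, hM⟩ := hJ.exists_le_maximal
  exact ⟨M, hM, fun a ha => hJM ⟨{a}, by simpa using ha, by simp⟩⟩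

namespace CIdeal

variable [hD : IsAlexandrovAlgebra D]

theorem finset_sup_mem (I : CIdeal D) (F : Finset D) (h : ∀ a ∈ F, a ∈ I.toLowerSet) :
    F.sup id ∈ I.toLowerSet := by
  refine I.mem_of_isLUB ↑F _ F.countable_toSet h ⟨?_, ?_⟩
  · exact fun a ha => Finset.le_sup (f := id) ha
  · exact fun y hy => Finset.sup_le fun a ha => hy ha

/-- A maximal ideal of a countably compact lattice is closed under countable joins. -/
def ofMaximal (hc : IsCountablyCompactLattice D) (M : Order.Ideal D) (hM : M.IsMaximal) :
    CIdeal D where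
  toLowerSet := M.toLowerSet
  mem_of_isLUB := by
    intro S x hS hSM hx
    by_contra hxM
    obtain ⟨e, he, hex⟩ := exists_sup_eq_top_of_isMaximal hM (a := x) hxM
    rcases S.eq_empty_or_nonempty with rfl | hne
    · have : x = ⊥ := by simpa using hx
      exact hxM (this ▸ Order.Ideal.bot_mem M)
    · obtain ⟨c, rfl⟩ := hS.exists_eq_range hne
      obtain ⟨H, hH⟩ := hc (fun n => e ⊔ c n) (by
        refine ⟨fun _ _ => le_top, fun y hy => ?_⟩
        rw [← hex]
        refine sup_le (le_sup_left.trans (hy ⟨0, rfl⟩)) (hx.2 ?_)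
        rintro _ ⟨n, rfl⟩
        exact le_sup_right.trans (hy ⟨n, rfl⟩))
      have h2 : H.sup (fun n => e ⊔ c n) ∈ M := by
        rw [Order.Ideal.finsetSup_mem_iff]
        exact fun n _ => Order.Ideal.sup_mem he (hSM ⟨n, rfl⟩)
      rw [hH] at h2
      exact Order.Ideal.IsProper.top_notMem hM.toIsProper h2

/-- The point of the frame given by a maximal ideal. -/
def pointOfMaximal (hc : IsCountablyCompactLattice D) (M : Order.Ideal D) (hM : M.IsMaximal) :
    Locale.PT (CIdeal D) where
  toFun I := ¬ I ≤ ofMaximal hc M hM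
  map_inf' I J := by
    have key : I ⊓ J ≤ ofMaximal hc M hM ↔ I ≤ ofMaximal hc M hM ∨ J ≤ ofMaximal hc M hM := by
      constructor
      · intro h
        by_contra! hcon
        obtain ⟨a, ha, haM⟩ := Set.not_subset.1 (fun h => hcon.1 (le_def.2 h))
        obtain ⟨b, hb, hbM⟩ := Set.not_subset.1 (fun h => hcon.2 (le_def.2 h))
        have hab : a ⊓ b ∈ M := by
          refine le_def.1 h ?_
          rw [coe_inf]
          exact ⟨I.toLowerSet.lower inf_le_left ha, J.toLowerSet.lower inf_le_right hb⟩
        exact (Order.Ideal.IsPrime.mem_or_mem inferInstance hab).elim haM hbM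
      · rintro (h | h)
        · exact inf_le_left.trans h
        · exact inf_le_right.trans h
    simp only [key, not_or]; rfl
  map_top' := by
    refine eq_true fun h => ?_
    refine Order.Ideal.IsProper.top_notMem hM.toIsProper (le_def.1 h ?_)
    rw [coe_top]; trivial
  map_sSup' s := by
    simp only [sSup_le_iff, not_forall, sSup_image, eq_iff_iff]
    simp

theorem compactSpace_PT (hc : IsCountablyCompactLattice D) :
    CompactSpace (Locale.PT (CIdeal D)) := by
  classical
  refine ⟨isCompact_of_finite_subcover fun {ι} U hU hcov => ?_⟩
  choose I hI using fun i => (Locale.PT.isOpen_iff _ _).1 (hU i)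
  by_cases hF : ∃ F : Finset D, (F : Set D) ⊆ {a | ∃ i, a ∈ (I i).toLowerSet} ∧ F.sup id = ⊤
  · obtain ⟨F, hFA, hF⟩ := hF
    choose i hi using fun a : F => hFA a.2
    refine ⟨F.attach.image i, fun p _ => ?_⟩
    have h1 : (⊤ : CIdeal D) ≤ F.attach.sup fun a => I (i a) := by
      have h2 : F.sup id ∈ (F.attach.sup fun a => I (i a)).toLowerSet :=
        finset_sup_mem _ F fun a ha =>
          le_def.1 (Finset.le_sup (f := fun a => I (i a)) (F.mem_attach ⟨a, ha⟩)) (hi ⟨a, ha⟩)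
      rw [hF] at h2
      exact le_def.2 fun x _ => LowerSet.lower _ le_top h2
    have h3 : p (F.attach.sup fun a => I (i a)) := by
      rw [top_le_iff.1 h1, map_top]; trivial
    rw [map_finset_sup, Finset.sup_eq_iSup] at h3
    simp only [iSup_Prop_eq] at h3
    obtain ⟨a, ha, hp⟩ := h3
    refine Set.mem_iUnion₂.2 ⟨i a, Finset.mem_image_of_mem i ha, ?_⟩
    rw [← hI]; exact hp
  · exfalso
    push Not at hF
    obtain ⟨M, hM, hAM⟩ := exists_isMaximal_of_finset _ hF
    obtain ⟨i, hi⟩ := Set.mem_iUnion.1 (hcov (Set.mem_univ (pointOfMaximal hc M hM)))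
    rw [← hI] at hi
    have hi' : ¬ I i ≤ ofMaximal hc M hM := hi
    exact hi' (le_def.2 fun a ha => hAM ⟨i, ha⟩)

theorem eq_iSup_principal (I : CIdeal D) :
    I = ⨆ a : {a // a ∈ I.toLowerSet}, principal a.1 := by
  apply le_antisymm
  · exact le_def.2 fun a ha => principal_le.1 (le_iSup
      (fun a : {a // a ∈ I.toLowerSet} => principal a.1) ⟨a, ha⟩)
  · exact iSup_le fun a => principal_le.2 a.2

theorem exists_disjoint_of_point {p q : Locale.PT (CIdeal D)} {I : CIdeal D} (hp : p I)
    (hq : ¬ q I) : ∃ J K : CIdeal D, p J ∧ q K ∧ J ⊓ K = ⊥ := by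
  rw [eq_iSup_principal I, map_iSup, iSup_Prop_eq] at hp
  obtain ⟨⟨a, ha⟩, hpa⟩ := hp
  have hqa : ¬ q (principal a) := fun h => hq (OrderHomClass.mono q (principal_le.2 ha) h)
  obtain ⟨b, c, hca, hbc⟩ := hD.approximation a
  have h1 : principal a ≤ ⨆ n, principal (c n) := by
    refine principal_le.2 (mem_of_isLUB _ (Set.range c) a (Set.countable_range c) ?_ hca)
    rintro _ ⟨n, rfl⟩
    exact principal_le.1 (le_iSup (fun n => principal (c n)) n)
  have h2 : p (⨆ n, principal (c n)) := OrderHomClass.mono p h1 hpa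
  rw [map_iSup, iSup_Prop_eq] at h2
  obtain ⟨n, hn⟩ := h2
  refine ⟨principal (c n), principal (b n), hn, ?_, ?_⟩
  · have h3 : (⊤ : CIdeal D) ≤ principal (b n) ⊔ principal a := by
      have h4 : b n ⊔ a ∈ (principal (b n) ⊔ principal a).toLowerSet := by
        refine mem_of_isLUB _ {b n, a} _ (Set.toFinite _).countable ?_ isLUB_pair
        rintro x (rfl | rfl)
        · exact principal_le.1 le_sup_left
        · exact principal_le.1 le_sup_right
      rw [(hbc n).2] at h4
      exact le_def.2 fun x _ => LowerSet.lower _ le_top h4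
    have h5 : q (principal (b n) ⊔ principal a) := by
      rw [top_le_iff.1 h3, map_top]; trivial
    rw [map_sup] at h5
    exact h5.resolve_right hqa
  · refine le_bot_iff.1 (le_def.2 fun x hx => ?_)
    rw [coe_inf] at hx
    have : x = ⊥ := le_bot_iff.1 ((le_inf hx.2 hx.1).trans (hbc n).1.le)
    rw [this]
    exact mem_of_isLUB _ ∅ ⊥ Set.countable_empty (Set.empty_subset _) (by simp)

theorem t2Space_PT : T2Space (Locale.PT (CIdeal D)) := by
  refine ⟨fun p q hpq => ?_⟩
  have key : ∀ p q : Locale.PT (CIdeal D), (∃ I, p I ∧ ¬ q I) → ∃ U V : Set (Locale.PT (CIdeal D)),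
      IsOpen U ∧ IsOpen V ∧ p ∈ U ∧ q ∈ V ∧ Disjoint U V := by
    rintro p q ⟨I, hp, hq⟩
    obtain ⟨J, K, hJ, hK, hJK⟩ := exists_disjoint_of_point hp hq
    refine ⟨{x | x J}, {x | x K}, ⟨J, rfl⟩, ⟨K, rfl⟩, hJ, hK, ?_⟩
    rw [Set.disjoint_left]
    intro x hx1 hx2
    have h : x (J ⊓ K) := by rw [map_inf]; exact ⟨hx1, hx2⟩
    rw [hJK, map_bot] at h
    exact h
  by_cases h : ∃ I, p I ∧ ¬ q I
  · exact key p q h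
  · have h' : ∃ I, q I ∧ ¬ p I := by
      by_contra h'
      push Not at h h'
      exact hpq (DFunLike.ext _ _ fun I => propext ⟨h I, h' I⟩)
    obtain ⟨U, V, hU, hV, hq, hp, hd⟩ := key q p h'
    exact ⟨V, U, hV, hU, hp, hq, hd.symm⟩

end CIdeal

end Points

/-! ### The maximal spectrum -/

section MaxSpec

variable (D : Type u) [DistribLattice D] [BoundedOrder D]

/-- The maximal ideals of a bounded distributive lattice. -/
def MaxSpec : Type u := {M : Order.Ideal D // M.IsMaximal}

namespace MaxSpec

variable {D}

/-- The basic open set `{M | d ∉ M}`. -/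
def basicOpen (d : D) : Set (MaxSpec D) := {M | d ∉ M.1}

/-- The topology with basic open sets `{M | d ∉ M}`. -/
instance : TopologicalSpace (MaxSpec D) :=
  TopologicalSpace.generateFrom (Set.range basicOpen)

theorem isOpen_basicOpen (d : D) : IsOpen (basicOpen d) :=
  TopologicalSpace.isOpen_generateFrom_of_mem ⟨d, rfl⟩

instance : CompactSpace (MaxSpec D) := by
  refine compactSpace_generateFrom rfl fun P hP hcov => ?_
  by_contra hcon
  push Not at hcon
  obtain ⟨M, hM, hAM⟩ := exists_isMaximal_of_finset {a : D | basicOpen a ∈ P} fun F hF h => by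
    refine hcon (basicOpen '' F) (by rintro _ ⟨a, ha, rfl⟩; exact hF ha)
      (F.finite_toSet.image _) ?_
    refine Set.eq_univ_of_forall fun M => ?_
    by_contra hM
    refine Order.Ideal.IsProper.top_notMem M.2.toIsProper ?_
    rw [← h, Order.Ideal.finsetSup_mem_iff]
    intro a ha
    by_contra haM
    exact hM ⟨basicOpen a, ⟨a, ha, rfl⟩, haM⟩
  have h2 : (⟨M, hM⟩ : MaxSpec D) ∈ ⋃₀ P := hcov ▸ Set.mem_univ _
  obtain ⟨U, hU, hMU⟩ := h2
  obtain ⟨a, rfl⟩ := hP hU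
  exact hMU (hAM hU)

theorem t2Space (hD : IsNormalLattice D) : T2Space (MaxSpec D) := by
  refine ⟨fun M N hMN => ?_⟩
  have h : ∃ a ∈ M.1, a ∉ N.1 := by
    by_contra! h
    have hle : M.1 ≤ N.1 := h
    rcases hle.lt_or_eq with h1 | h1
    · exact N.2.toIsProper.ne_top (M.2.isCoatom.2 _ h1)
    · exact hMN (Subtype.ext h1)
  obtain ⟨a, haM, haN⟩ := h
  obtain ⟨b, hbN, hba⟩ := exists_sup_eq_top_of_isMaximal N.2 haN
  obtain ⟨c, d, hcb, had, hcd⟩ := hD b a hba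
  refine ⟨basicOpen d, basicOpen c, isOpen_basicOpen d, isOpen_basicOpen c, ?_, ?_, ?_⟩
  · intro hd
    exact Order.Ideal.IsProper.top_notMem M.2.toIsProper (had ▸ Order.Ideal.sup_mem haM hd)
  · intro hc
    exact Order.Ideal.IsProper.top_notMem N.2.toIsProper (hcb ▸ Order.Ideal.sup_mem hc hbN)
  · rw [Set.disjoint_left]
    intro K hd hc
    have h0 : c ⊓ d ∈ K.1 := by rw [hcd]; exact Order.Ideal.bot_mem _
    have := K.2
    exact (Order.Ideal.IsPrime.mem_or_mem inferInstance h0).elim hc hd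

/-- The continuous map induced by a maximal homomorphism: inverse image of ideals. -/
def map {E : Type u} [DistribLattice E] [BoundedOrder E] (f : BoundedLatticeHom D E)
    (hf : IsMaximalHom f) : C(MaxSpec E, MaxSpec D) where
  toFun M := ⟨idealPreimage f M.1, hf M.1 M.2⟩
  continuous_toFun := by
    refine continuous_generateFrom_iff.2 ?_
    rintro _ ⟨d, rfl⟩
    exact isOpen_basicOpen (f d)

end MaxSpec

end MaxSpec

/-! ### Lattices of cozero sets -/

section Coz

open TopologicalSpace (Opens)

/-- The lattice of cozero sets `{x | f x ≠ 0}` of continuous functions `f : X → ℝ`, as a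
sublattice of the lattice of open sets. -/
def cozSublattice (X : Type u) [TopologicalSpace X] : Sublattice (Opens X) where
  carrier := {U | ∃ f : C(X, ℝ), ∀ x, x ∈ U ↔ f x ≠ 0}
  supClosed' := by
    rintro U ⟨f, hf⟩ V ⟨g, hg⟩
    refine ⟨f * f + g * g, fun x => ?_⟩
    have : x ∈ U ⊔ V ↔ x ∈ U ∨ x ∈ V := Iff.rfl
    rw [this, hf, hg]
    simp only [ContinuousMap.add_apply, ContinuousMap.mul_apply, ne_eq,
      mul_self_add_mul_self_eq_zero]
    tauto
  infClosed' := by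
    rintro U ⟨f, hf⟩ V ⟨g, hg⟩
    refine ⟨f * g, fun x => ?_⟩
    have : x ∈ U ⊓ V ↔ x ∈ U ∧ x ∈ V := Iff.rfl
    rw [this, hf, hg]
    simp

/-- The lattice of cozero sets of a topological space. -/
abbrev Coz (X : Type u) [TopologicalSpace X] : Type u := cozSublattice X

namespace Coz

variable {X : Type u} [TopologicalSpace X]

instance : BoundedOrder (Coz X) where
  top := ⟨⊤, 1, fun x => by simp⟩
  le_top U := (le_top : U.1 ≤ ⊤)
  bot := ⟨⊥, 0, fun x => by simp⟩
  bot_le U := (bot_le : ⊥ ≤ U.1)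

theorem mem_sup {U V : Coz X} {x : X} : x ∈ (U ⊔ V).1 ↔ x ∈ U.1 ∨ x ∈ V.1 := Iff.rfl

theorem mem_inf {U V : Coz X} {x : X} : x ∈ (U ⊓ V).1 ↔ x ∈ U.1 ∧ x ∈ V.1 := Iff.rfl

theorem mem_top (x : X) : x ∈ (⊤ : Coz X).1 := trivial

theorem notMem_bot (x : X) : x ∉ (⊥ : Coz X).1 := id

theorem eq_top_iff_mem {U : Coz X} : U = ⊤ ↔ ∀ x, x ∈ U.1 :=
  ⟨fun h x => h ▸ mem_top x, fun h => top_le_iff.1 fun x _ => h x⟩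

theorem eq_bot_iff_notMem {U : Coz X} : U = ⊥ ↔ ∀ x, x ∉ U.1 :=
  ⟨fun h x => h ▸ notMem_bot x, fun h => le_bot_iff.1 fun x hx => (h x hx).elim⟩

theorem exists_fun (U : Coz X) : ∃ f : C(X, ℝ), ∀ x, x ∈ U.1 ↔ f x ≠ 0 := U.2

/-- The cozero set on which a continuous function is positive. -/
def pos (f : C(X, ℝ)) : Coz X :=
  ⟨⟨{x | 0 < f x}, isOpen_lt continuous_const f.continuous⟩, f ⊔ 0, fun x => by
    change 0 < f x ↔ f x ⊔ 0 ≠ 0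
    rw [ne_eq, sup_eq_right, not_le]⟩

theorem mem_pos {f : C(X, ℝ)} {x : X} : x ∈ (pos f).1 ↔ 0 < f x := Iff.rfl

theorem exists_nonneg (U : Coz X) :
    ∃ f : C(X, ℝ), (∀ x, 0 ≤ f x) ∧ ∀ x, x ∈ U.1 ↔ 0 < f x := by
  obtain ⟨f, hf⟩ := U.2
  exact ⟨|f|, fun x => abs_nonneg _, fun x => (hf x).trans abs_pos.symm⟩

theorem exists_iUnion (U : ℕ → Coz X) : ∃ V : Coz X, ∀ x, x ∈ V.1 ↔ ∃ n, x ∈ (U n).1 := by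
  choose f hf0 hf using fun n => exists_nonneg (U n)
  have hb : ∀ n x, ‖(1 / 2 : ℝ) ^ n * min (f n x) 1‖ ≤ (1 / 2 : ℝ) ^ n := by
    intro n x
    have h1 : 0 ≤ min (f n x) 1 := le_min (hf0 n x) zero_le_one
    rw [Real.norm_of_nonneg (by positivity)]
    exact mul_le_of_le_one_right (by positivity) (min_le_right _ _)
  have hs : Summable fun n : ℕ => (1 / 2 : ℝ) ^ n := summable_geometric_two
  have hnn : ∀ n x, 0 ≤ (1 / 2 : ℝ) ^ n * min (f n x) 1 := fun n x =>
    mul_nonneg (by positivity) (le_min (hf0 n x) zero_le_one)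
  let F : C(X, ℝ) := ⟨fun x => ∑' n, (1 / 2 : ℝ) ^ n * min (f n x) 1,
    continuous_tsum (fun n => by fun_prop) hs hb⟩
  refine ⟨pos F, fun x => ?_⟩
  have hsx : Summable fun n => (1 / 2 : ℝ) ^ n * min (f n x) 1 :=
    Summable.of_norm_bounded hs fun n => hb n x
  rw [mem_pos]
  constructor
  · intro h
    by_contra! hcon
    have h0 : ∀ n, (1 / 2 : ℝ) ^ n * min (f n x) 1 = 0 := by
      intro n
      have h1 : f n x = 0 := le_antisymm (not_lt.1 fun h => hcon n ((hf n x).2 h)) (hf0 n x)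
      simp [h1]
    have h2 : F x = 0 := by
      change ∑' n, (1 / 2 : ℝ) ^ n * min (f n x) 1 = 0
      rw [tsum_congr h0, tsum_zero]
    exact h.ne' h2
  · rintro ⟨n, hn⟩
    have h1 : 0 < min (f n x) 1 := lt_min ((hf n x).1 hn) zero_lt_one
    exact hsx.tsum_pos (fun n => hnn n x) n (by positivity)

theorem exists_sUnion {S : Set (Coz X)} (hS : S.Countable) :
    ∃ V : Coz X, ∀ x, x ∈ V.1 ↔ ∃ U ∈ S, x ∈ U.1 := by
  rcases S.eq_empty_or_nonempty with rfl | hne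
  · exact ⟨⊥, fun x => by simp [notMem_bot]⟩
  · obtain ⟨c, rfl⟩ := hS.exists_eq_range hne
    obtain ⟨V, hV⟩ := exists_iUnion c
    exact ⟨V, fun x => by simp [hV]⟩

/-- Countable joins of cozero sets are unions. -/
theorem isLUB_iff {S : Set (Coz X)} (hS : S.Countable) {V : Coz X} :
    IsLUB S V ↔ ∀ x, x ∈ V.1 ↔ ∃ U ∈ S, x ∈ U.1 := by
  have key : ∀ W : Coz X, (∀ x, x ∈ W.1 ↔ ∃ U ∈ S, x ∈ U.1) → IsLUB S W := fun W hW =>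
    ⟨fun U hU x hx => (hW x).2 ⟨U, hU, hx⟩, fun Z hZ x hx => by
      obtain ⟨U, hU, hxU⟩ := (hW x).1 hx
      exact hZ hU hxU⟩
  refine ⟨fun h => ?_, key V⟩
  obtain ⟨W, hW⟩ := exists_sUnion hS
  rw [h.unique (key W hW)]
  exact hW

theorem isNormalLattice : IsNormalLattice (Coz X) := by
  intro U V hUV
  rw [eq_top_iff_mem] at hUV
  obtain ⟨f, hf0, hf⟩ := exists_nonneg U
  obtain ⟨g, hg0, hg⟩ := exists_nonneg V
  refine ⟨pos (g - f), pos (f - g), ?_, ?_, ?_⟩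
  · rw [eq_top_iff_mem]
    intro x
    rw [mem_sup, mem_pos, hf, ContinuousMap.sub_apply]
    have := hUV x
    rw [mem_sup, hf, hg] at this
    by_cases h : 0 < f x
    · exact .inr h
    · exact .inl (by have h1 := this.resolve_left h; linarith)
  · rw [eq_top_iff_mem]
    intro x
    rw [mem_sup, mem_pos, hg, ContinuousMap.sub_apply]
    have := hUV x
    rw [mem_sup, hf, hg] at this
    by_cases h : 0 < g x
    · exact .inl h
    · exact .inr (by have h1 := this.resolve_right h; linarith)
  · rw [eq_bot_iff_notMem]
    intro x
    rw [mem_inf, mem_pos, mem_pos, ContinuousMap.sub_apply, ContinuousMap.sub_apply]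
    rintro ⟨h1, h2⟩
    linarith

instance : IsAlexandrovAlgebra (Coz X) where
  normal := isNormalLattice
  exists_isLUB S hS := by
    obtain ⟨V, hV⟩ := exists_sUnion hS
    exact ⟨V, (isLUB_iff hS).2 hV⟩
  inf_isLUB U S V hS hV := by
    rw [isLUB_iff hS] at hV
    rw [isLUB_iff (hS.image _)]
    intro x
    rw [mem_inf, hV]
    simp only [Set.exists_mem_image, mem_inf]
    tauto
  approximation U := by
    obtain ⟨f, hf0, hf⟩ := exists_nonneg U
    refine ⟨fun n => pos (.const X (1 / ((n : ℝ) + 1)) - f),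
      fun n => pos (f - .const X (1 / ((n : ℝ) + 1))), ?_, fun n => ⟨?_, ?_⟩⟩
    · rw [isLUB_iff (Set.countable_range _)]
      intro x
      simp only [Set.exists_range_iff, mem_pos, hf, ContinuousMap.sub_apply,
        ContinuousMap.const_apply, sub_pos]
      constructor
      · exact fun h => exists_nat_one_div_lt h
      · rintro ⟨n, hn⟩
        exact lt_trans (by positivity) hn
    · rw [eq_bot_iff_notMem]
      intro x
      rw [mem_inf, mem_pos, mem_pos, ContinuousMap.sub_apply, ContinuousMap.sub_apply]
      rintro ⟨h1, h2⟩
      linarith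
    · rw [eq_top_iff_mem]
      intro x
      rw [mem_sup, mem_pos, hf, ContinuousMap.sub_apply, ContinuousMap.const_apply]
      by_cases h : 0 < f x
      · exact .inr h
      · left
        have h1 : (0 : ℝ) < 1 / ((n : ℝ) + 1) := by positivity
        have := hf0 x
        linarith

theorem isCountablyCompactLattice [CompactSpace X] : IsCountablyCompactLattice (Coz X) := by
  intro c hc
  rw [isLUB_iff (Set.countable_range _)] at hc
  obtain ⟨H, hH⟩ := isCompact_univ.elim_finite_subcover (fun n => ((c n).1 : Set X))
    (fun n => (c n).1.isOpen) fun x _ => by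
      obtain ⟨_, ⟨n, rfl⟩, hn⟩ := (hc x).1 (mem_top x)
      exact Set.mem_iUnion.2 ⟨n, hn⟩
  refine ⟨H, eq_top_iff_mem.2 fun x => ?_⟩
  obtain ⟨n, hn, hx⟩ := Set.mem_iUnion₂.1 (hH (Set.mem_univ x))
  exact (Finset.le_sup (f := c) hn : c n ≤ H.sup c) hx

/-- A cozero set containing `x` together with some cozero set not containing `x` covers `X`. -/
theorem exists_sup_eq_top {U : Coz X} {x : X} (hx : x ∈ U.1) :
    ∃ V : Coz X, U ⊔ V = ⊤ ∧ x ∉ V.1 := by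
  obtain ⟨f, hf0, hf⟩ := exists_nonneg U
  refine ⟨pos (.const X (f x) - f), ?_, ?_⟩
  · rw [eq_top_iff_mem]
    intro y
    rw [mem_sup, mem_pos, hf, ContinuousMap.sub_apply, ContinuousMap.const_apply]
    have h1 := (hf x).1 hx
    by_cases h : 0 < f y
    · exact .inl h
    · exact .inr (by linarith)
  · rw [mem_pos]
    simp

theorem isConjunctive : IsConjunctive (Coz X) := by
  intro U V h x hx
  obtain ⟨W, hW, hxW⟩ := exists_sup_eq_top hx
  have := eq_top_iff_mem.1 (h W hW) x
  exact (mem_sup.1 this).resolve_right hxW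

/-- The ideal of cozero sets not containing a given point. -/
def idealOfPoint (x : X) : Order.Ideal (Coz X) where
  carrier := {U | x ∉ U.1}
  lower' _ _ hVU hU hV := hU (hVU hV)
  nonempty' := ⟨⊥, notMem_bot x⟩
  directed' U hU V hV := ⟨U ⊔ V, fun h => (mem_sup.1 h).elim hU hV, le_sup_left, le_sup_right⟩

theorem isMaximal_idealOfPoint (x : X) : (idealOfPoint x).IsMaximal := by
  have hp : (idealOfPoint x).IsProper :=
    Order.Ideal.isProper_iff_top_notMem.2 fun h => h (mem_top x)
  refine { hp with maximal_proper := fun J hJ => ?_ }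
  obtain ⟨U, hUJ, hU⟩ := Set.exists_of_ssubset hJ
  have hxU : x ∈ U.1 := not_not.1 hU
  obtain ⟨V, hV, hxV⟩ := exists_sup_eq_top hxU
  have hVJ : V ∈ J := hJ.le hxV
  have htop : (⊤ : Coz X) ∈ J := hV ▸ Order.Ideal.sup_mem hUJ hVJ
  exact Set.eq_univ_of_forall fun W => J.lower le_top htop

theorem eq_idealOfPoint [CompactSpace X] (M : Order.Ideal (Coz X)) (hM : M.IsMaximal) :
    ∃ x, M = idealOfPoint x := by
  have h : ∃ x : X, ∀ U ∈ M, x ∉ U.1 := by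
    by_contra! hcon
    obtain ⟨F, hF⟩ := isCompact_univ.elim_finite_subcover
      (fun U : {U // U ∈ M} => (U.1.1 : Set X)) (fun U => U.1.1.isOpen) fun x _ => by
        obtain ⟨U, hU, hx⟩ := hcon x
        exact Set.mem_iUnion.2 ⟨⟨U, hU⟩, hx⟩
    refine Order.Ideal.IsProper.top_notMem hM.toIsProper ?_
    have h1 : F.sup (fun U => U.1) ∈ M := by
      rw [Order.Ideal.finsetSup_mem_iff]
      exact fun U _ => U.2
    have h2 : F.sup (fun U => U.1) = ⊤ := eq_top_iff_mem.2 fun x => by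
      obtain ⟨U, hU, hx⟩ := Set.mem_iUnion₂.1 (hF (Set.mem_univ x))
      exact (Finset.le_sup (f := fun U : {U // U ∈ M} => U.1) hU) hx
    rwa [h2] at h1
  obtain ⟨x, hx⟩ := h
  refine ⟨x, ?_⟩
  by_contra hne
  have hlt : M < idealOfPoint x := lt_of_le_of_ne hx hne
  exact (isMaximal_idealOfPoint x).toIsProper.ne_top (hM.isCoatom.2 _ hlt)

variable {Y : Type u} [TopologicalSpace Y]

/-- The homomorphism `U ↦ f ⁻¹ U` induced by a continuous map. -/
def map (f : C(X, Y)) : BoundedLatticeHom (Coz Y) (Coz X) where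
  toFun U := ⟨Opens.comap f U.1, by
    obtain ⟨g, hg⟩ := U.2
    exact ⟨g.comp f, fun x => hg (f x)⟩⟩
  map_sup' _ _ := rfl
  map_inf' _ _ := rfl
  map_top' := rfl
  map_bot' := rfl

theorem mem_map {f : C(X, Y)} {U : Coz Y} {x : X} : x ∈ (map f U).1 ↔ f x ∈ U.1 := Iff.rfl

theorem preservesCountableJoins_map (f : C(X, Y)) : PreservesCountableJoins (map f) := by
  intro S V hS hV
  rw [isLUB_iff hS] at hV
  rw [isLUB_iff (hS.image _)]
  intro x
  rw [mem_map, hV]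
  simp only [Set.exists_mem_image, mem_map]

theorem isMaximalHom_map [CompactSpace X] (f : C(X, Y)) : IsMaximalHom (map f) := by
  intro M hM
  obtain ⟨x, rfl⟩ := eq_idealOfPoint M hM
  exact isMaximal_idealOfPoint (f x)

end Coz

end Coz

/-! ### The functors -/

instance (D : AlexAlgC.{u}) : IsAlexandrovAlgebra D.obj := D.property.1

instance (D : AlexAlgC.{u}) : CompactSpace (Locale.PT (CIdeal D.obj)) :=
  CIdeal.compactSpace_PT D.property.2

instance (D : AlexAlgC.{u}) : T2Space (Locale.PT (CIdeal D.obj)) :=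
  CIdeal.t2Space_PT

/-- The lattice of cozero sets as a functor to countably compact Alexandrov algebras; a continuous
map `f` is sent to `f⁻¹`. -/
def cozAlex : CompHaus.{u}ᵒᵖ ⥤ AlexAlgC.{u} where
  obj X := ⟨BddDistLat.of (Coz X.unop), inferInstance, Coz.isCountablyCompactLattice⟩
  map f := ⟨BddDistLat.ofHom (Coz.map (ConcreteCategory.hom f.unop)),
    Coz.preservesCountableJoins_map _⟩

/-- The functor sending a countably compact Alexandrov algebra to the space of points of its frame
of ideals for the countable topology (frame homomorphisms to `Prop`, with the open sets
`{p | p I}`), and a morphism to precomposition with the induced frame homomorphism. -/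
def pointsAlex : AlexAlgC.{u} ⥤ CompHaus.{u}ᵒᵖ where
  obj D := op (CompHaus.of (Locale.PT (CIdeal D.obj)))
  map {D E} f := (CompHausLike.ofHom _
    { toFun := fun p => p.comp (CIdeal.map f.hom.hom f.property)
      continuous_toFun := continuous_def.2 <| by
        rintro _ ⟨I, rfl⟩
        exact ⟨CIdeal.map f.hom.hom f.property I, rfl⟩ } :
      CompHaus.of (Locale.PT (CIdeal E.obj)) ⟶ CompHaus.of (Locale.PT (CIdeal D.obj))).op
  map_id D := by
    refine congrArg Quiver.Hom.op (ConcreteCategory.hom_ext _ _ fun p => ?_)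
    change p.comp (CIdeal.map (BddDistLat.Hom.hom (𝟙 D.obj)) _) = p
    exact (congrArg p.comp (CIdeal.map_id _)).trans (FrameHom.comp_id p)
  map_comp f g := by
    refine congrArg Quiver.Hom.op (ConcreteCategory.hom_ext _ _ fun p => ?_)
    exact congrArg p.comp (CIdeal.map_comp g.hom.hom g.property f.hom.hom f.property _)

/-- The lattice is conjunctive and isomorphic to the lattice of cozero sets of a compact Hausdorff
space. -/
def IsCozLattice (D : BddDistLat.{u}) : Prop :=
  IsConjunctive D ∧ ∃ X : CompHaus.{u}, Nonempty (D ≅ BddDistLat.of (Coz X))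

/-- The category of (conjunctive) lattices isomorphic to the lattice of cozero sets of a compact
Hausdorff space, and maximal homomorphisms. -/
abbrev CHDLat := SubDLat.{u} IsCozLattice maximalHoms

theorem IsCozLattice.isNormalLattice {D : BddDistLat.{u}} (hD : IsCozLattice D) :
    IsNormalLattice D := by
  obtain ⟨-, X, ⟨e⟩⟩ := hD
  intro a b hab
  obtain ⟨c, d, h1, h2, h3⟩ := Coz.isNormalLattice (e.hom a) (e.hom b) (by
    rw [← map_sup, hab, map_top])
  refine ⟨e.inv c, e.inv d, ?_, ?_, ?_⟩
  · have := congrArg e.inv h1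
    simpa using this
  · have := congrArg e.inv h2
    simpa using this
  · have := congrArg e.inv h3
    simpa using this

instance (D : CHDLat.{u}) : T2Space (MaxSpec D.obj) :=
  MaxSpec.t2Space D.property.isNormalLattice

/-- The lattice of cozero sets as a functor to `CHDLat`; a continuous map `f` is sent to `f⁻¹`. -/
def cozCHDLat : CompHaus.{u}ᵒᵖ ⥤ CHDLat.{u} where
  obj X := ⟨BddDistLat.of (Coz X.unop), Coz.isConjunctive, X.unop, ⟨Iso.refl _⟩⟩
  map f := ⟨BddDistLat.ofHom (Coz.map (ConcreteCategory.hom f.unop)), Coz.isMaximalHom_map _⟩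

/-- The maximal spectrum as a functor on `CHDLat`; a morphism is sent to inverse image of maximal
ideals. -/
def maxCHDLat : CHDLat.{u} ⥤ CompHaus.{u}ᵒᵖ where
  obj D := op (CompHaus.of (MaxSpec D.obj))
  map {D E} f := (CompHausLike.ofHom _ (MaxSpec.map f.hom.hom f.property) :
      CompHaus.of (MaxSpec E.obj) ⟶ CompHaus.of (MaxSpec D.obj)).op

/-! ### Maximal ideals, countable joins and maximal homomorphisms -/

section MaximalIdeals

variable {D E : Type u} [DistribLattice D] [BoundedOrder D] [DistribLattice E] [BoundedOrder E]

/-! The theorem rests on one characterization: in a countably compact Alexandrov algebra the maximal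
ideals are exactly the prime ideals closed under countable joins. Countable compactness gives
closure of maximal ideals (`Order.Ideal.IsMaximal.mem_of_isLUB`); the approximation property gives
maximality of closed primes (`isMaximal_of_isPrime`).

Three things follow. Preimage along a homomorphism preserving countable joins keeps primeness and
closure, so such a homomorphism is maximal; conversely, conjunctivity lets maximal ideals test
inequalities, so a maximal homomorphism preserves countable joins. Next, a point of the frame of
ideals is determined by its values on principal ideals, and the elements where it vanishes form a
closed prime; hence `C` and `Max` agree naturally (`CIdeal.bijective_ofMaxSpec`). Finally, `d ↦
basicOpen d` identifies `D` with `Coz (MaxSpec D)` (`MaxSpec.orderIsoCoz`): it embeds by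
conjunctivity, its values are open `F_σ` sets and so cozero sets by Urysohn's lemma, and every
cozero set arises as a countable union of compact sets that can be enclosed in basic open sets.

For a compact Hausdorff `X`, sending a point to its ideal is a continuous bijection onto `MaxSpec
(Coz X)`. This proves the duality for `Max`; the one for `C` is transported along the identification
of the two subcategories. -/

theorem isMaximal_of_exists_sup_eq_top {N : Order.Ideal D} (hN : N.IsProper)
    (h : ∀ a ∉ N, ∃ e ∈ N, e ⊔ a = ⊤) : N.IsMaximal := by
  refine { hN with maximal_proper := fun J hJ => ?_ }
  obtain ⟨a, haJ, haN⟩ := Set.exists_of_ssubset hJ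
  obtain ⟨e, heN, hea⟩ := h a haN
  have htop : (⊤ : D) ∈ J := hea ▸ Order.Ideal.sup_mem (hJ.le heN) haJ
  exact Set.eq_univ_of_forall fun x => J.lower le_top htop

theorem Order.Ideal.IsMaximal.eq_of_le {M N : Order.Ideal D} (hM : M.IsMaximal)
    (hN : N.IsProper) (h : M ≤ N) : M = N := by
  by_contra hne
  exact hN.ne_top (hM.isCoatom.2 _ (lt_of_le_of_ne h hne))

/-- In an Alexandrov algebra, prime ideals closed under countable joins are maximal. -/
theorem isMaximal_of_isPrime [hD : IsAlexandrovAlgebra D] {N : Order.Ideal D} (hN : N.IsPrime)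
    (h : ∀ (S : Set D) (x : D), S.Countable → S ⊆ N → IsLUB S x → x ∈ N) : N.IsMaximal := by
  refine isMaximal_of_exists_sup_eq_top hN.toIsProper fun a ha => ?_
  obtain ⟨b, c, hca, hbc⟩ := hD.approximation a
  -- Since `a` is the join of the `c n`, closure forbids all of them from lying in `N`. Primeness
  -- then puts the matching `b n` in `N`, and `b n ⊔ a = ⊤`.
  have hn : ∃ n, c n ∉ N := by
    by_contra! hcon
    exact ha (h _ a (Set.countable_range c) (Set.range_subset_iff.2 hcon) hca)
  obtain ⟨n, hn⟩ := hn
  have hmem : b n ⊓ c n ∈ N := (hbc n).1 ▸ Order.Ideal.bot_mem N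
  exact ⟨b n, (hN.mem_or_mem hmem).resolve_right hn, (hbc n).2⟩

/-- If `x ∉ M`, some `e ∈ M` has `e ⊔ x = ⊤`; countable compactness then joins `e` with finitely
many members of `S` to `⊤`, which would lie in `M`. -/
theorem Order.Ideal.IsMaximal.mem_of_isLUB [IsAlexandrovAlgebra D]
    (hc : IsCountablyCompactLattice D) {M : Order.Ideal D} (hM : M.IsMaximal) {S : Set D} {x : D}
    (hS : S.Countable) (hSM : S ⊆ M) (hx : IsLUB S x) : x ∈ M :=
  (CIdeal.ofMaximal hc M hM).mem_of_isLUB S x hS hSM hx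

/-- It suffices to bound each approximant `d n` of `a` by `b`. Its disjoint partner `c n` covers
together with `a`, hence together with `b`, so all of `d n` must lie in `b`. -/
theorem IsAlexandrovAlgebra.isConjunctive [hD : IsAlexandrovAlgebra D] : IsConjunctive D := by
  intro a b h
  obtain ⟨c, d, hda, hcd⟩ := hD.approximation a
  refine hda.2 ?_
  rintro _ ⟨n, rfl⟩
  have h1 : b ⊔ c n = ⊤ := h _ (by rw [sup_comm]; exact (hcd n).2)
  calc d n = d n ⊓ (b ⊔ c n) := by rw [h1, inf_top_eq]
    _ = d n ⊓ b := by rw [inf_sup_left, inf_comm (d n) (c n), (hcd n).1, sup_bot_eq]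
    _ ≤ b := inf_le_right

/-- Conjunctivity says that a failure of `a ≤ b` is witnessed by some `c` with `a ⊔ c = ⊤` and `b ⊔
c ≠ ⊤`; a maximal ideal containing `b` and `c` then omits `a`. -/
theorem MaxSpec.basicOpen_subset_iff (hD : IsConjunctive D) {a b : D} :
    basicOpen a ⊆ basicOpen b ↔ a ≤ b := by
  constructor
  · refine fun h => hD a b fun c hac => ?_
    by_contra hbc
    obtain ⟨M, hM, hsub⟩ := exists_isMaximal_of_finset {b, c} fun F hF htop => hbc <| by
      refine top_le_iff.1 (htop ▸ Finset.sup_le fun x hx => ?_)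
      obtain rfl | rfl : x = b ∨ x = c := hF hx
      · exact le_sup_left
      · exact le_sup_right
    have haM : a ∈ M := by
      by_contra haM
      exact h (show (⟨M, hM⟩ : MaxSpec D) ∈ basicOpen a from haM) (hsub (Or.inl rfl))
    have hcM : c ∈ M := hsub (Or.inr rfl)
    exact hM.toIsProper.top_notMem (hac ▸ Order.Ideal.sup_mem haM hcM)
  · exact fun h M ha hb => ha (M.1.lower h hb)

theorem PreservesCountableJoins.isMaximalHom [IsAlexandrovAlgebra D] [IsAlexandrovAlgebra E]
    (hE : IsCountablyCompactLattice E) {f : BoundedLatticeHom D E}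
    (hf : PreservesCountableJoins f) : IsMaximalHom f := by
  intro M hM
  have hproper : (idealPreimage f M).IsProper := by
    rw [Order.Ideal.isProper_iff_top_notMem, mem_idealPreimage, map_top]
    exact hM.toIsProper.top_notMem
  refine isMaximal_of_isPrime (Order.Ideal.IsPrime.of_mem_or_mem fun {x y} hxy => ?_)
    fun S x hS hSM hx => ?_
  · rw [mem_idealPreimage, map_inf] at hxy
    exact Order.Ideal.IsPrime.mem_or_mem (I := M) inferInstance hxy
  · exact hM.mem_of_isLUB hE (hS.image f) (Set.image_subset_iff.2 hSM) (hf S x hS hx)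

/-- Suppose an upper bound `y` of `f '' S` lies in a maximal ideal `M`. The preimage of `M` is
maximal and contains `S`, hence contains the join `x`, so `f x ∈ M`. As maximal ideals detect the
order, `f x ≤ y`. -/
theorem IsMaximalHom.preservesCountableJoins [IsAlexandrovAlgebra D] [IsAlexandrovAlgebra E]
    (hD : IsCountablyCompactLattice D) {f : BoundedLatticeHom D E} (hf : IsMaximalHom f) :
    PreservesCountableJoins f := by
  intro S x hS hx
  refine ⟨?_, fun y hy => ?_⟩
  · rintro _ ⟨s, hs, rfl⟩
    exact OrderHomClass.mono f (hx.1 hs)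
  · rw [← MaxSpec.basicOpen_subset_iff IsAlexandrovAlgebra.isConjunctive]
    intro M hM hy'
    exact hM ((hf M.1 M.2).mem_of_isLUB hD hS (fun s hs => M.1.lower (hy ⟨s, hs, rfl⟩) hy') hx)

end MaximalIdeals

/-! ### Cozero sets of the maximal spectrum, and points of `X` as maximal ideals of `Coz X` -/

section MaxSpecCoz

open TopologicalSpace

/-- In a normal space, an open `F_σ` set is a cozero set. -/
theorem Coz.exists_eq_of_iUnion_isClosed {X : Type u} [TopologicalSpace X] [NormalSpace X]
    (U : Opens X) (K : ℕ → Set X) (hK : ∀ n, IsClosed (K n)) (hU : (U : Set X) = ⋃ n, K n) :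
    ∃ V : Coz X, V.1 = U := by
  have h : ∀ n, ∃ V : Coz X, K n ⊆ V.1 ∧ V.1 ≤ U := by
    intro n
    have hKU : K n ⊆ U := hU ▸ Set.subset_iUnion K n
    -- Urysohn function equal to `0` off `U` and `1` on `K n`; its cozero set lies between `K n` and
    -- `U`.
    obtain ⟨f, hf0, hf1, -⟩ := exists_continuous_zero_one_of_isClosed U.isOpen.isClosed_compl
      (hK n) (Set.disjoint_compl_left_iff_subset.2 hKU)
    refine ⟨Coz.pos f, fun x hx => ?_, fun x hx => ?_⟩
    · have : f x = 1 := hf1 hx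
      exact Coz.mem_pos.2 (this ▸ one_pos)
    · by_contra hxU
      have : f x = 0 := hf0 hxU
      exact (Coz.mem_pos.1 hx).ne' this
  choose V hKV hVU using h
  obtain ⟨W, hW⟩ := Coz.exists_iUnion V
  refine ⟨W, Opens.ext (Set.ext fun x => ?_)⟩
  rw [SetLike.mem_coe, hW]
  refine ⟨fun ⟨n, hn⟩ => hVU n hn, fun hx => ?_⟩
  rw [hU] at hx
  obtain ⟨n, hn⟩ := Set.mem_iUnion.1 hx
  exact ⟨n, hKV n hn⟩

namespace MaxSpec

variable {D : Type u} [DistribLattice D] [BoundedOrder D]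

theorem basicOpen_inf (a b : D) : basicOpen (a ⊓ b) = basicOpen a ∩ basicOpen b := by
  ext M
  have := M.2
  refine ⟨fun h => ⟨fun ha => h (M.1.lower inf_le_left ha), fun hb => h (M.1.lower inf_le_right hb)⟩,
    fun ⟨ha, hb⟩ hab => ?_⟩
  exact (Order.Ideal.IsPrime.mem_or_mem inferInstance hab).elim ha hb

theorem basicOpen_top : basicOpen (⊤ : D) = Set.univ :=
  Set.eq_univ_of_forall fun M => M.2.toIsProper.top_notMem

theorem isTopologicalBasis_basicOpen : IsTopologicalBasis (Set.range (basicOpen (D := D))) := by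
  refine isTopologicalBasis_of_subbasis_of_finiteInter rfl ⟨⟨⊤, basicOpen_top⟩, ?_⟩
  rintro _ ⟨a, rfl⟩ _ ⟨b, rfl⟩
  exact ⟨a ⊓ b, basicOpen_inf a b⟩

theorem basicOpen_finset_sup {ι : Type*} (F : Finset ι) (a : ι → D) :
    basicOpen (F.sup a) = ⋃ i ∈ F, basicOpen (a i) := by
  ext M
  change F.sup a ∉ M.1 ↔ _
  rw [Order.Ideal.finsetSup_mem_iff]
  simp [basicOpen]

/-- Between a compact set and an open set containing it there is a basic open set. -/
theorem exists_basicOpen_of_isCompact {K U : Set (MaxSpec D)} (hK : IsCompact K) (hU : IsOpen U)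
    (hKU : K ⊆ U) : ∃ a : D, K ⊆ basicOpen a ∧ basicOpen a ⊆ U := by
  -- The finite subcover is again a single basic open set, since `basicOpen` turns finite joins into
  -- unions.
  obtain ⟨F, hF⟩ := hK.elim_finite_subcover (fun a : {a : D // basicOpen a ⊆ U} => basicOpen a.1)
    (fun a => isOpen_basicOpen a.1) fun x hx => by
      obtain ⟨_, ⟨a, rfl⟩, hxa, haU⟩ :=
        isTopologicalBasis_basicOpen.exists_subset_of_mem_open (hKU hx) hU
      exact Set.mem_iUnion.2 ⟨⟨a, haU⟩, hxa⟩
  refine ⟨F.sup Subtype.val, ?_, ?_⟩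
  · rwa [basicOpen_finset_sup]
  · rw [basicOpen_finset_sup]
    exact Set.iUnion₂_subset fun a _ => a.2

variable [hD : IsAlexandrovAlgebra D]

/-- This is closure of maximal ideals under countable joins, read contrapositively. -/
theorem basicOpen_eq_iUnion (hc : IsCountablyCompactLattice D) {c : ℕ → D} {a : D}
    (h : IsLUB (Set.range c) a) : basicOpen a = ⋃ n, basicOpen (c n) := by
  ext M
  rw [Set.mem_iUnion]
  constructor
  · intro ha
    by_contra! hcon
    exact ha (M.2.mem_of_isLUB hc (Set.countable_range c)
      (Set.range_subset_iff.2 fun n => not_not.1 (hcon n)) h)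
  · rintro ⟨n, hn⟩ ha
    exact hn (M.1.lower (h.1 ⟨n, rfl⟩) ha)

/-- The closed set `(basicOpen (b n))ᶜ` lies between `basicOpen (c n)` and `basicOpen a`:
disjointness gives the first inclusion, `b n ⊔ a = ⊤` the second. So `basicOpen a` is an open `F_σ`
set. -/
theorem exists_coz_eq_basicOpen (hc : IsCountablyCompactLattice D) (a : D) :
    ∃ V : Coz (MaxSpec D), V.1 = ⟨basicOpen a, isOpen_basicOpen a⟩ := by
  have := t2Space hD.normal
  obtain ⟨b, c, hca, hbc⟩ := hD.approximation a
  refine Coz.exists_eq_of_iUnion_isClosed _ (fun n => (basicOpen (b n))ᶜ)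
    (fun n => (isOpen_basicOpen _).isClosed_compl) (Set.Subset.antisymm ?_ ?_)
  · change basicOpen a ⊆ _
    rw [basicOpen_eq_iUnion hc hca]
    refine Set.iUnion_mono fun n M hcM hbM => ?_
    have h0 : b n ⊓ c n ∈ M.1 := (hbc n).1 ▸ Order.Ideal.bot_mem _
    have := M.2
    exact (Order.Ideal.IsPrime.mem_or_mem inferInstance h0).elim hbM hcM
  · refine Set.iUnion_subset fun n M hM ha => ?_
    exact M.2.toIsProper.top_notMem ((hbc n).2 ▸ Order.Ideal.sup_mem (not_not.1 hM) ha)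

/-- The cozero set is exhausted by the compact sets `{1 / (n + 1) ≤ f}`. Enclosing each in a basic
open set inside `V` and joining the corresponding elements of `D` gives the required element. -/
theorem exists_basicOpen_eq_coz (hc : IsCountablyCompactLattice D) (V : Coz (MaxSpec D)) :
    ∃ a : D, basicOpen a = V.1 := by
  obtain ⟨f, -, hf⟩ := Coz.exists_nonneg V
  have hK : ∀ n : ℕ, IsClosed {x | 1 / ((n : ℝ) + 1) ≤ f x} := fun n =>
    isClosed_le continuous_const f.continuous
  have hKV : ∀ n : ℕ, {x | 1 / ((n : ℝ) + 1) ≤ f x} ⊆ V.1 := fun n x hx =>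
    (hf x).2 (lt_of_lt_of_le (by positivity) hx)
  choose a hKa haV using fun n =>
    exists_basicOpen_of_isCompact (hK n).isCompact V.1.isOpen (hKV n)
  obtain ⟨x, hx⟩ := hD.exists_isLUB _ (Set.countable_range a)
  refine ⟨x, ?_⟩
  rw [basicOpen_eq_iUnion hc hx]
  refine Set.Subset.antisymm (Set.iUnion_subset haV) fun M hM => ?_
  obtain ⟨n, hn⟩ := exists_nat_one_div_lt ((hf M).1 hM)
  exact Set.mem_iUnion.2 ⟨n, hKa n hn.le⟩

/-- A countably compact Alexandrov algebra is the lattice of cozero sets of its maximal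
spectrum. -/
noncomputable def orderIsoCoz (hc : IsCountablyCompactLattice D) : D ≃o Coz (MaxSpec D) :=
  RelIso.ofSurjective
    (OrderEmbedding.ofMapLEIff (fun a => ⟨⟨basicOpen a, isOpen_basicOpen a⟩, by
      obtain ⟨V, hV⟩ := exists_coz_eq_basicOpen hc a
      exact hV ▸ V.2⟩)
      fun _ _ => basicOpen_subset_iff IsAlexandrovAlgebra.isConjunctive)
    fun V => by
      obtain ⟨a, ha⟩ := exists_basicOpen_eq_coz hc V
      exact ⟨a, Subtype.ext (Opens.ext ha)⟩

end MaxSpec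

/-- A Urysohn function that is `0` at `x` and `1` at `y` has a cozero set belonging to the ideal of
`x` but not to that of `y`. -/
theorem Coz.injective_idealOfPoint {X : Type u} [TopologicalSpace X] [CompactSpace X] [T2Space X] :
    Function.Injective (idealOfPoint (X := X)) := by
  intro x y hxy
  by_contra hne
  obtain ⟨f, hf0, hf1, -⟩ := exists_continuous_zero_one_of_isClosed (isClosed_singleton (x := x))
    (isClosed_singleton (x := y)) (by simpa using hne)
  have hx : f x = 0 := hf0 rfl
  have hy : f y = 1 := hf1 rfl
  have h : pos f ∈ idealOfPoint x := fun h => (mem_pos.1 h).ne' hx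
  rw [hxy] at h
  exact h (mem_pos.2 (hy ▸ one_pos))

/-- The continuous map sending a point to the ideal of cozero sets not containing it. -/
def Coz.toMaxSpec (X : Type u) [TopologicalSpace X] : C(X, MaxSpec (Coz X)) where
  toFun x := ⟨idealOfPoint x, isMaximal_idealOfPoint x⟩
  continuous_toFun := by
    refine continuous_generateFrom_iff.2 ?_
    rintro _ ⟨U, rfl⟩
    convert U.1.isOpen using 1
    ext x
    exact not_not

/-- A compact Hausdorff space is homeomorphic to the maximal spectrum of its lattice of cozero
sets. -/
theorem Coz.bijective_toMaxSpec {X : Type u} [TopologicalSpace X] [CompactSpace X] [T2Space X] :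
    Function.Bijective (toMaxSpec X) := by
  refine ⟨fun x y hxy => injective_idealOfPoint (congrArg Subtype.val hxy), fun M => ?_⟩
  obtain ⟨x, hx⟩ := eq_idealOfPoint M.1 M.2
  exact ⟨x, Subtype.ext hx.symm⟩

end MaxSpecCoz

/-! ### Points of the frame of ideals as maximal ideals -/

section PointsMaxSpec

namespace CIdeal

variable {D : Type u} [DistribLattice D] [BoundedOrder D] [hD : IsAlexandrovAlgebra D]

theorem apply_iff_exists_principal (p : Locale.PT (CIdeal D)) (I : CIdeal D) :
    p I ↔ ∃ a ∈ I.toLowerSet, p (principal a) := by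
  conv_lhs => rw [eq_iSup_principal I, map_iSup, iSup_Prop_eq]
  simp

/-- A point of the frame of ideals vanishes at the join of a countable family of principal ideals
at which it vanishes. -/
theorem not_apply_principal_of_isLUB (p : Locale.PT (CIdeal D)) {S : Set D} {x : D}
    (hS : S.Countable) (hp : ∀ s ∈ S, ¬ p (principal s)) (hx : IsLUB S x) :
    ¬ p (principal x) := by
  have h : principal x ≤ ⨆ s : S, principal s.1 :=
    principal_le.2 (mem_of_isLUB _ S x hS
      (fun s hs => principal_le.1 (le_iSup (fun s : S => principal s.1) ⟨s, hs⟩)) hx)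
  intro hpx
  have h2 := OrderHomClass.mono p h hpx
  rw [map_iSup, iSup_Prop_eq] at h2
  obtain ⟨s, hs⟩ := h2
  exact hp s.1 s.2 hs

/-- The ideal of elements at which a point of the frame of ideals vanishes. -/
def idealOfPoint (p : Locale.PT (CIdeal D)) : Order.Ideal D where
  carrier := {a | ¬ p (principal a)}
  lower' _ _ hba ha hb := ha (OrderHomClass.mono p (principal_le.2 hba) hb)
  -- `⊥` is the join of the empty family.
  nonempty' := ⟨⊥, not_apply_principal_of_isLUB p Set.countable_empty (by simp) (by simp)⟩
  directed' a ha b hb := ⟨a ⊔ b, not_apply_principal_of_isLUB p (Set.toFinite {a, b}).countable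
    (by rintro x (rfl | rfl) <;> assumption) isLUB_pair, le_sup_left, le_sup_right⟩

theorem mem_idealOfPoint {p : Locale.PT (CIdeal D)} {a : D} :
    a ∈ idealOfPoint p ↔ ¬ p (principal a) := Iff.rfl

/-- Preservation of finite meets makes the ideal prime and preservation of joins makes it closed
under countable joins, so `isMaximal_of_isPrime` applies. -/
theorem isMaximal_idealOfPoint (p : Locale.PT (CIdeal D)) : (idealOfPoint p).IsMaximal := by
  have htop : p (principal ⊤) := by
    have h : principal (⊤ : D) = ⊤ :=
      top_le_iff.1 (le_def.2 fun x _ => (le_top : x ≤ ⊤))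
    rw [h, map_top]; trivial
  have hproper : (idealOfPoint p).IsProper :=
    Order.Ideal.isProper_iff_top_notMem.2 fun h => h htop
  refine isMaximal_of_isPrime (Order.Ideal.IsPrime.of_mem_or_mem fun {x y} hxy => ?_)
    fun S x hS hSM hx => not_apply_principal_of_isLUB p hS hSM hx
  by_contra! hcon
  simp only [mem_idealOfPoint, not_not] at hcon hxy
  have h : principal x ⊓ principal y ≤ principal (x ⊓ y) := le_def.2 <| by
    rw [coe_inf]
    exact fun z hz => le_inf hz.1 hz.2
  refine hxy (OrderHomClass.mono p h ?_)
  rw [map_inf]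
  exact hcon

theorem pointOfMaximal_apply {hc : IsCountablyCompactLattice D} {M : Order.Ideal D}
    {hM : M.IsMaximal} {I : CIdeal D} :
    pointOfMaximal hc M hM I ↔ ∃ a ∈ I.toLowerSet, a ∉ M :=
  Set.not_subset

/-- The continuous map sending a maximal ideal to the corresponding point of the frame of
ideals. -/
def ofMaxSpec (hc : IsCountablyCompactLattice D) : C(MaxSpec D, Locale.PT (CIdeal D)) where
  toFun M := pointOfMaximal hc M.1 M.2
  continuous_toFun := continuous_def.2 <| by
    rintro _ ⟨I, rfl⟩
    have h : (fun M : MaxSpec D => pointOfMaximal hc M.1 M.2) ⁻¹' {p | p I} =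
        ⋃ a ∈ I.toLowerSet, MaxSpec.basicOpen a := by
      ext M
      simpa using! pointOfMaximal_apply
    rw [h]
    exact isOpen_biUnion fun a _ => MaxSpec.isOpen_basicOpen a

theorem ofMaxSpec_apply {hc : IsCountablyCompactLattice D} {M : MaxSpec D} {I : CIdeal D} :
    ofMaxSpec hc M I ↔ ∃ a ∈ I.toLowerSet, a ∉ M.1 :=
  pointOfMaximal_apply

/-- Both halves evaluate at principal ideals: these values recover the maximal ideal, and they
determine a point because every ideal is the join of the principal ideals below it. -/
theorem bijective_ofMaxSpec (hc : IsCountablyCompactLattice D) :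
    Function.Bijective (ofMaxSpec hc) := by
  refine ⟨fun M N hMN => Subtype.ext (M.2.eq_of_le N.2.toIsProper fun a ha => ?_), fun p => ?_⟩
  · by_contra haN
    have h : ofMaxSpec hc N (principal a) := ofMaxSpec_apply.2 ⟨a, le_rfl, haN⟩
    rw [← hMN, ofMaxSpec_apply] at h
    obtain ⟨b, hba, hb⟩ := h
    exact hb (M.1.lower hba ha)
  · let M : MaxSpec D := ⟨idealOfPoint p, isMaximal_idealOfPoint p⟩
    have hM : ∀ a, a ∉ M.1 ↔ p (principal a) := fun a => not_not
    refine ⟨M, DFunLike.ext _ _ fun I => propext ?_⟩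
    rw [ofMaxSpec_apply, apply_iff_exists_principal]
    simp only [hM]

/-- Naturality of the comparison between maximal ideals and points. -/
theorem ofMaxSpec_comp_map {E : Type u} [DistribLattice E] [BoundedOrder E]
    [IsAlexandrovAlgebra E] (hc : IsCountablyCompactLattice D) (hc' : IsCountablyCompactLattice E)
    (f : BoundedLatticeHom D E) (hf : PreservesCountableJoins f) (hf' : IsMaximalHom f)
    (M : MaxSpec E) :
    (ofMaxSpec hc' M).comp (map f hf) = ofMaxSpec hc (MaxSpec.map f hf' M) := by
  refine DFunLike.ext _ _ fun I => propext ?_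
  rw [ofMaxSpec_apply]
  change ¬ map f hf I ≤ ofMaximal hc' M.1 M.2 ↔ _
  -- By adjunction, the generated ideal lies in `M` exactly when `f` maps `I` into `M`.
  rw [map_le_iff]
  push Not
  exact Iff.rfl

end CIdeal

end PointsMaxSpec

/-! ### Transport along order isomorphisms -/

section OrderIso

variable {D E : Type u} [DistribLattice D] [BoundedOrder D] [DistribLattice E] [BoundedOrder E]

theorem IsNormalLattice.of_orderIso (e : D ≃o E) (hE : IsNormalLattice E) :
    IsNormalLattice D := by
  intro a b hab
  obtain ⟨c, d, h1, h2, h3⟩ := hE (e a) (e b) (by rw [← map_sup, hab, map_top])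
  exact ⟨e.symm c, e.symm d, by simpa using congrArg e.symm h1, by simpa using congrArg e.symm h2,
    by simpa using congrArg e.symm h3⟩

theorem IsAlexandrovAlgebra.of_orderIso (e : D ≃o E) [hE : IsAlexandrovAlgebra E] :
    IsAlexandrovAlgebra D where
  normal := hE.normal.of_orderIso e
  exists_isLUB S hS := by
    obtain ⟨x, hx⟩ := hE.exists_isLUB (e '' S) (hS.image e)
    exact ⟨e.symm x, e.isLUB_image.1 hx⟩
  inf_isLUB a S x hS hx := by
    have h := hE.inf_isLUB (e a) (e '' S) (e x) (hS.image e) (e.isLUB_image'.2 hx)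
    rw [← e.isLUB_image', map_inf, Set.image_image]
    simpa only [Set.image_image, map_inf] using h
  approximation a := by
    obtain ⟨b, c, hca, hbc⟩ := hE.approximation (e a)
    refine ⟨fun n => e.symm (b n), fun n => e.symm (c n), ?_, fun n => ⟨?_, ?_⟩⟩
    · rw [← e.isLUB_image', ← Set.range_comp]
      simpa [Function.comp_def] using hca
    · rw [← map_inf, (hbc n).1, map_bot]
    · simpa using congrArg e.symm (hbc n).2

theorem IsCountablyCompactLattice.of_orderIso (e : D ≃o E) (hE : IsCountablyCompactLattice E) :
    IsCountablyCompactLattice D := by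
  intro c hc
  obtain ⟨H, hH⟩ := hE (fun n => e (c n)) (by
    have h := e.isLUB_image'.2 hc
    rwa [map_top, ← Set.range_comp] at h)
  refine ⟨H, e.injective ?_⟩
  rw [map_finset_sup, map_top]
  exact hH

end OrderIso

/-! ### Natural isomorphisms and assembly of the dualities -/

section Categories

/-- The order isomorphism underlying an isomorphism of bounded distributive lattices. -/
def CategoryTheory.Iso.toBddDistLatOrderIso {D E : BddDistLat.{u}} (i : D ≅ E) : D ≃o E where
  toFun := i.hom
  invFun := i.inv
  left_inv x := by simp
  right_inv x := by simp
  map_rel_iff' {a b} := by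
    refine ⟨fun h => ?_, fun h => OrderHomClass.mono i.hom.hom h⟩
    have h2 := OrderHomClass.mono i.inv.hom h
    simpa using h2

theorem countableJoinHoms_hom {D E : BddDistLat.{u}} (i : D ≅ E) : countableJoinHoms i.hom :=
  fun _ _ _ hx => i.toBddDistLatOrderIso.isLUB_image'.2 hx

/-- Forwards, the witnessing space is the maximal spectrum; backwards, the structure of `Coz X` is
transported along the isomorphism. -/
theorem isCountablyCompactAlexandrov_iff_isCozLattice (D : BddDistLat.{u}) :
    IsCountablyCompactAlexandrov D ↔ IsCozLattice D := by
  constructor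
  · rintro ⟨hD, hc⟩
    have := MaxSpec.t2Space hD.normal
    exact ⟨hD.isConjunctive, CompHaus.of (MaxSpec D),
      ⟨BddDistLat.Iso.mk (β := .of (Coz (MaxSpec D))) (MaxSpec.orderIsoCoz hc)⟩⟩
  · rintro ⟨-, X, ⟨i⟩⟩
    exact ⟨.of_orderIso (E := Coz X) i.toBddDistLatOrderIso,
      Coz.isCountablyCompactLattice.of_orderIso (E := Coz X) i.toBddDistLatOrderIso⟩

theorem countableJoinHoms_iff_maximalHoms (D E : BddDistLat.{u})
    (hD : IsCountablyCompactAlexandrov D) (hE : IsCountablyCompactAlexandrov E) (f : D ⟶ E) :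
    countableJoinHoms f ↔ maximalHoms f := by
  have := hD.1
  have := hE.1
  exact ⟨fun hf => PreservesCountableJoins.isMaximalHom hE.2 hf,
    fun hf => IsMaximalHom.preservesCountableJoins hD.2 hf⟩

theorem CHDLat.isCountablyCompactAlexandrov (D : CHDLat.{u}) :
    IsCountablyCompactAlexandrov D.obj :=
  (isCountablyCompactAlexandrov_iff_isCozLattice D.obj).2 D.property

instance (D : CHDLat.{u}) : IsAlexandrovAlgebra D.obj := D.isCountablyCompactAlexandrov.1

/-- Isomorphic lattices are isomorphic in `CHDLat`. -/
def CHDLat.isoMk {D E : CHDLat.{u}} (i : D.obj ≅ E.obj) : D ≅ E where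
  hom := ⟨i.hom, (countableJoinHoms_iff_maximalHoms _ _ D.isCountablyCompactAlexandrov
    E.isCountablyCompactAlexandrov _).1 (countableJoinHoms_hom i)⟩
  inv := ⟨i.inv, (countableJoinHoms_iff_maximalHoms _ _ E.isCountablyCompactAlexandrov
    D.isCountablyCompactAlexandrov _).1 (countableJoinHoms_hom i.symm)⟩
  hom_inv_id := SubDLat.Hom.ext i.hom_inv_id
  inv_hom_id := SubDLat.Hom.ext i.inv_hom_id

/-- Compact Hausdorff spaces are naturally homeomorphic to the maximal spectra of their lattices of
cozero sets. -/
noncomputable def cozMaxUnitIso : 𝟭 CompHaus.{u}ᵒᵖ ≅ cozCHDLat ⋙ maxCHDLat :=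
  (NatIso.ofComponents
    -- A continuous bijection of compact Hausdorff spaces is a homeomorphism. Passing to the
    -- opposite category reverses it, hence the final `symm`.
    (fun X => (CompHausLike.isoOfBijective (X := X.unop)
      (Y := (maxCHDLat.obj (cozCHDLat.obj X)).unop)
      (CompHausLike.ofHom _ (Coz.toMaxSpec X.unop)) Coz.bijective_toMaxSpec).op)
    fun _ => rfl : cozCHDLat ⋙ maxCHDLat ≅ 𝟭 CompHaus.{u}ᵒᵖ).symm

/-- Lattices in `CHDLat` are naturally isomorphic to the lattices of cozero sets of their maximal
spectra. -/
noncomputable def maxCozCounitIso : maxCHDLat.{u} ⋙ cozCHDLat ≅ 𝟭 CHDLat.{u} :=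
  (NatIso.ofComponents
    (fun D => CHDLat.isoMk (BddDistLat.Iso.mk (α := D.obj) (β := .of (Coz (MaxSpec D.obj)))
      (MaxSpec.orderIsoCoz D.isCountablyCompactAlexandrov.2)))
    -- Naturality is definitional: the preimage of `basicOpen d` under `MaxSpec.map f` is `basicOpen
    -- (f d)`.
    fun _ => rfl : 𝟭 CHDLat.{u} ≅ maxCHDLat.{u} ⋙ cozCHDLat).symm

/-- The identification of countably compact Alexandrov algebras with lattices of cozero sets. -/
abbrev alexToCHD : AlexAlgC.{u} ⥤ CHDLat.{u} :=
  SubDLat.identification isCountablyCompactAlexandrov_iff_isCozLattice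
    countableJoinHoms_iff_maximalHoms

/-- The inverse of the identification of countably compact Alexandrov algebras with lattices of
cozero sets. -/
abbrev chdToAlex : CHDLat.{u} ⥤ AlexAlgC.{u} :=
  SubDLat.identification (fun D => (isCountablyCompactAlexandrov_iff_isCozLattice D).symm)
    fun D E hD hE f => (countableJoinHoms_iff_maximalHoms D E
      ((isCountablyCompactAlexandrov_iff_isCozLattice D).2 hD)
      ((isCountablyCompactAlexandrov_iff_isCozLattice E).2 hE) f).symm

/-- The space of points of the frame of ideals is naturally homeomorphic to the maximal
spectrum. -/
noncomputable def pointsAlexIso : pointsAlex.{u} ≅ alexToCHD ⋙ maxCHDLat :=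
  NatIso.ofComponents
    (fun D => (CompHausLike.isoOfBijective (X := (maxCHDLat.obj (alexToCHD.obj D)).unop)
      (Y := (pointsAlex.obj D).unop)
      (CompHausLike.ofHom _ (CIdeal.ofMaxSpec (D := D.obj) D.property.2))
      (CIdeal.bijective_ofMaxSpec (D := D.obj) D.property.2)).op)
    fun {D E} f => congrArg Quiver.Hom.op <| ConcreteCategory.hom_ext _ _ fun M =>
      CIdeal.ofMaxSpec_comp_map (D := D.obj) (E := E.obj) D.property.2 E.property.2 f.hom.hom f.property
        ((alexToCHD.map f).property) M

/-- The unit of the duality between compact Hausdorff spaces and countably compact Alexandrov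
algebras. -/
noncomputable def cozPointsUnitIso : 𝟭 CompHaus.{u}ᵒᵖ ≅ cozAlex ⋙ pointsAlex :=
  cozMaxUnitIso ≪≫ (Functor.isoWhiskerLeft cozAlex pointsAlexIso).symm

/-- The counit of the duality between compact Hausdorff spaces and countably compact Alexandrov
algebras. -/
noncomputable def pointsCozCounitIso : pointsAlex.{u} ⋙ cozAlex ≅ 𝟭 AlexAlgC.{u} :=
  -- The pieces compose because `cozCHDLat ⋙ chdToAlex` is definitionally `cozAlex` and the two
  -- identifications are definitionally inverse.
  Functor.isoWhiskerRight pointsAlexIso cozAlex ≪≫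
    Functor.isoWhiskerLeft alexToCHD (Functor.isoWhiskerRight maxCozCounitIso chdToAlex)

end Categories

theorem theorem3p5 :
    -- `Coz` and `C` are mutually inverse dualities
    (∃ e : CompHaus.{u}ᵒᵖ ≌ AlexAlgC.{u}, e.functor = cozAlex ∧ e.inverse = pointsAlex) ∧
    -- `Coz` and `Max` are mutually inverse dualities
    (∃ e : CompHaus.{u}ᵒᵖ ≌ CHDLat.{u}, e.functor = cozCHDLat ∧ e.inverse = maxCHDLat) ∧
    -- the two subcategories of bounded distributive lattices are equal, and `C` is isomorphic
    -- to `Max` under this identification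
    (∃ (hobj : ∀ D : BddDistLat.{u}, IsCountablyCompactAlexandrov D ↔ IsCozLattice D)
      (hmor : ∀ D E : BddDistLat.{u}, IsCountablyCompactAlexandrov D →
        IsCountablyCompactAlexandrov E → ∀ f : D ⟶ E, countableJoinHoms f ↔ maximalHoms f),
      Nonempty (pointsAlex.{u} ≅ SubDLat.identification hobj hmor ⋙ maxCHDLat.{u})) :=
  -- `Equivalence.mk` adjusts the unit to obtain the triangle identity and leaves both functors
  -- unchanged, so they agree by `rfl`.
  ⟨⟨CategoryTheory.Equivalence.mk cozAlex pointsAlex cozPointsUnitIso pointsCozCounitIso, rfl, rfl⟩,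
    ⟨CategoryTheory.Equivalence.mk cozCHDLat maxCHDLat cozMaxUnitIso maxCozCounitIso, rfl, rfl⟩,
    isCountablyCompactAlexandrov_iff_isCozLattice, countableJoinHoms_iff_maximalHoms,
    ⟨pointsAlexIso⟩⟩
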